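/- Let $m_D,m_{s_D},a_D,m_E,m_{s_E},a_E>0$ be real, and let $\gamma_D,\gamma_E$ (the instantaneous signal-to-noise ratios of the main and of the eavesdropper's channel) be independent random variables such that, for $k\in\{D,E\}$, $\gamma_k$ has the Fisher–Snedecor $\mathcal F$ density $$f_k(x)=\frac{a_k^{m_k}}{B(m_k,m_{s_k})}\,\frac{x^{m_k-1}}{(1+a_kx)^{m_k+m_{s_k}}}\quad(x>0),\qquad f_k(x)=0\quad(x\le 0),$$ where $B$ is the beta function. (In the fading model $a_k=m_k/(m_{s_k}\overline\gamma_k)$ with an average-SNR parameter $\overline\gamma_k>0$.) Let $C_s=\max\{\ln(1+\gamma_D)-\ln(1+\gamma_E),\,0\}$ be the secrecy capacity. Then $$\Pr\{C_s>0\}=\Pr\{\gamma_D>\gamma_E\}=\frac{1}{\Gamma(m_D)\Gamma(m_{s_D})\Gamma(m_E)\Gamma(m_{s_E})}\;\mathrm G^{3,2}_{3,3}\!\left(\frac{a_D}{a_E}\,\middle|\,\begin{matrix}1-m_{s_D},\,1-m_E,\,1\\ m_D,\,m_{s_E},\,0\end{matrix}\right).$$ Here the Meijer $\mathrm G$-function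 is given by $$\mathrm G^{m,n}_{p,q}\!\left(z\,\middle|\,\begin{matrix}\alpha_1,\dots,\alpha_p\\ \beta_1,\dots,\beta_q\end{matrix}\right)=\frac1{2\pi i}\int_{L}\frac{\prod_{j=1}^m\Gamma(\beta_j+s)\prod_{j=1}^n\Gamma(1-\alpha_j-s)}{\prod_{j=n+1}^p\Gamma(\alpha_j+s)\prod_{j=m+1}^q\Gamma(1-\beta_j-s)}\,z^{-s}\,ds,$$ where $L$ is an upward vertical line that has the poles of all $\Gamma(\beta_j+s)$, $j\le m$, on its left and the poles of all $\Gamma(1-\alpha_j-s)$, $j\le n$, on its right. For the parameters above such lines exist (namely $\operatorname{Re}s=c$ with $0<c<\min\{m_{s_D},m_E\}$), and along each of them the integral converges absolutely and has the same value. -/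

import Mathlib

noncomputable section

/-- The integrand of the Mellin–Barnes integral that defines the Meijer function
`G^{m,n}_{p,q}(z | a ; b)`:
`∏_{j ≤ m} Γ(b_j + s) ∏_{j ≤ n} Γ(1 - a_j - s) /
  (∏_{j > n} Γ(a_j + s) ∏_{j > m} Γ(1 - b_j - s)) * z ^ (-s)`.
The reciprocal Gamma function vanishes at the poles of `Γ`, which agrees with Mathlib's
`Complex.Gamma` being `0` there. -/
def meijerGIntegrand (m n : ℕ) {p q : ℕ} (a : Fin p → ℂ) (b : Fin q → ℂ) (z s : ℂ) : ℂ :=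
  ((∏ j : Fin q with j.val < m, Complex.Gamma (b j + s)) *
      (∏ j : Fin p with j.val < n, Complex.Gamma (1 - a j - s))) /
    ((∏ j : Fin p with n ≤ j.val, Complex.Gamma (a j + s)) *
      (∏ j : Fin q with m ≤ j.val, Complex.Gamma (1 - b j - s))) *
    z ^ (-s)

/-- The upward vertical line `Re s = c` separates the poles `-b_j - k` (`j ≤ m`, `k = 0, 1, …`) of
the factors `Γ(b_j + s)`, which lie to its left, from the poles `1 - a_j + k` (`j ≤ n`,
`k = 0, 1, …`) of the factors `Γ(1 - a_j - s)`, which lie to its right. -/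
def MeijerGSeparates (m n : ℕ) {p q : ℕ} (a : Fin p → ℂ) (b : Fin q → ℂ) (c : ℝ) : Prop :=
  (∀ j : Fin q, (j : ℕ) < m → ∀ k : ℕ, (-b j - (k : ℂ)).re < c) ∧
    (∀ j : Fin p, (j : ℕ) < n → ∀ k : ℕ, c < (1 - a j + (k : ℂ)).re)

/-- The Mellin–Barnes integral `(2πi)⁻¹ ∫ f(s) ds`, for `f` the Meijer integrand, taken along the
vertical line from `c - i∞` to `c + i∞`, parametrized by `s = c + i y`, `ds = i dy`. -/
def meijerGLineIntegral (m n : ℕ) {p q : ℕ} (a : Fin p → ℂ) (b : Fin q → ℂ) (z : ℂ) (c : ℝ) : ℂ :=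
  (2 * (Real.pi : ℂ) * Complex.I)⁻¹ *
    ∫ y : ℝ, meijerGIntegrand m n a b z ((c : ℂ) + (y : ℂ) * Complex.I) * Complex.I

/-- `HasMeijerG m n a b z w`: some vertical line separates the two families of poles and, along
every such line, the Mellin–Barnes integral for `G^{m,n}_{p,q}(z | a ; b)` converges absolutely
and has the value `w`. -/
def HasMeijerG (m n : ℕ) {p q : ℕ} (a : Fin p → ℂ) (b : Fin q → ℂ) (z w : ℂ) : Prop :=
  (∃ c : ℝ, MeijerGSeparates m n a b c) ∧
    ∀ c : ℝ, MeijerGSeparates m n a b c →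
      MeasureTheory.Integrable
          (fun y : ℝ => meijerGIntegrand m n a b z ((c : ℂ) + (y : ℂ) * Complex.I)) ∧
        meijerGLineIntegral m n a b z c = w

open Classical in
/-- The Meijer function `G^{m,n}_{p,q}(z | a ; b)`, with the Mellin–Barnes contour a vertical line
that separates the poles; the junk value `0` is used when the defining integral does not exist
in the sense of `HasMeijerG`. -/
def meijerG (m n : ℕ) {p q : ℕ} (a : Fin p → ℂ) (b : Fin q → ℂ) (z : ℂ) : ℂ :=
  if h : ∃ w, HasMeijerG m n a b z w then h.choose else 0

theorem HasMeijerG.unique {m n p q : ℕ} {a : Fin p → ℂ} {b : Fin q → ℂ} {z w w' : ℂ}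
    (h : HasMeijerG m n a b z w) (h' : HasMeijerG m n a b z w') : w = w' := by
  obtain ⟨c, hc⟩ := h.1
  exact (h.2 c hc).2.symm.trans (h'.2 c hc).2

theorem HasMeijerG.meijerG_eq {m n p q : ℕ} {a : Fin p → ℂ} {b : Fin q → ℂ} {z w : ℂ}
    (h : HasMeijerG m n a b z w) : meijerG m n a b z = w := by
  have hex : ∃ w, HasMeijerG m n a b z w := ⟨w, h⟩
  rw [meijerG, dif_pos hex]
  exact hex.choose_spec.unique h

/-- The density of the Fisher–Snedecor `F` distribution with fading parameter `m`, shadowing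
parameter `ms` and scale parameter `a`:
`a ^ m / B(m, ms) * x ^ (m - 1) / (1 + a x) ^ (m + ms)` for `x > 0`, and `0` otherwise. -/
def fisherSnedecorPDF (m ms a x : ℝ) : ℝ :=
  if 0 < x then
    a ^ m / ProbabilityTheory.beta m ms * (x ^ (m - 1) / (1 + a * x) ^ (m + ms))
  else 0

/-- The Fisher–Snedecor `F` distribution, as a measure on `ℝ`. -/
def fisherSnedecorMeasure (m ms a : ℝ) : MeasureTheory.Measure ℝ :=
  MeasureTheory.volume.withDensity fun x => ENNReal.ofReal (fisherSnedecorPDF m ms a x)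

/-- The capacity (in nats) of the additive white Gaussian noise channel with signal-to-noise
ratio `γ`. -/
def awgnCapacity (γ : ℝ) : ℝ := Real.log (1 + γ)

/-- The secrecy capacity `[C_D - C_E]⁺` for the instantaneous signal-to-noise ratios `γD` of the
main channel and `γE` of the eavesdropper's channel. -/
def secrecyCapacity (γD γE : ℝ) : ℝ := max (awgnCapacity γD - awgnCapacity γE) 0

end

open MeasureTheory ProbabilityTheory Set Filter Topology

/-! Put `W = γD / γE`; the probability sought is the tail `t ↦ P(t < W)` at `t = 1`. The Mellin
transform of this tail at `s` is `E[W ^ s] / s` (Fubini), and by independence `E[W ^ s] = E[γD ^ s]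
E[γE ^ (-s)]`. Each moment is a beta integral, hence a product of two Gamma values and a power of
the scale. Since `1 / s = Γ(s) / Γ(1 + s)`, the transform is, up to the constant product of Gammas,
exactly the Meijer integrand at `z = aD / aE`.

Mellin inversion at `t = 1` therefore gives the formula on every separating line. It needs two
facts: integrability of the transform along the line (`integrable_Gamma_mul_Gamma_div`), and
continuity of the tail at `1`, which holds because ties `γD = γE` have probability `0`. -/

/-! ### Complex moments of the Fisher–Snedecor distribution -/

/-- The Mellin transform of `(1 + x) ^ (-(u + v))` at `u` is the beta function. -/
theorem hasMellin_one_add_cpow_neg {u v : ℂ} (hu : 0 < u.re) (hv : 0 < v.re) :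
    HasMellin (fun x : ℝ => (1 + (x : ℂ)) ^ (-(u + v))) u
      (Complex.Gamma u * Complex.Gamma v / Complex.Gamma (u + v)) := by
  -- The substitution `x = t / (1 - t)` turns the Mellin integral into Euler's beta integral.
  have himage : (fun t : ℝ => t / (1 - t)) '' Ioo 0 1 = Ioi 0 := by
    ext x
    constructor
    · rintro ⟨t, ht, rfl⟩
      exact div_pos ht.1 (sub_pos.2 ht.2)
    · intro hx
      have hx : 0 < x := hx
      refine ⟨x / (1 + x), ⟨by positivity, ?_⟩, ?_⟩
      · rw [div_lt_one (by positivity)]; linarith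
      · dsimp only
        field_simp
        ring
  have hderiv : ∀ t ∈ Ioo (0 : ℝ) 1,
      HasDerivWithinAt (fun t : ℝ => t / (1 - t)) (1 / (1 - t) ^ 2) (Ioo 0 1) t := by
    intro t ht
    have h1 : 1 - t ≠ 0 := (sub_pos.2 ht.2).ne'
    have h := (hasDerivAt_id t).div ((hasDerivAt_id t).const_sub 1) h1
    refine (h.congr_deriv ?_).hasDerivWithinAt
    simp
  have hinj : InjOn (fun t : ℝ => t / (1 - t)) (Ioo 0 1) := by
    intro t ht t' ht' h
    have h1 : 1 - t ≠ 0 := (sub_pos.2 ht.2).ne'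
    have h2 : 1 - t' ≠ 0 := (sub_pos.2 ht'.2).ne'
    have h : t / (1 - t) = t' / (1 - t') := h
    rw [div_eq_div_iff h1 h2] at h
    linarith
  have hcongr : EqOn (fun t : ℝ => |1 / (1 - t) ^ 2| •
      ((((t / (1 - t) : ℝ) : ℂ) ^ (u - 1)) • (1 + ((t / (1 - t) : ℝ) : ℂ)) ^ (-(u + v))))
      (fun t : ℝ => (t : ℂ) ^ (u - 1) * (1 - (t : ℂ)) ^ (v - 1)) (Ioo 0 1) := by
    intro t ht
    have ht0 := ht.1
    have h1 : 0 < 1 - t := sub_pos.2 ht.2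
    have e0 : (1 + ((t / (1 - t) : ℝ) : ℂ)) = (((1 - t)⁻¹ : ℝ) : ℂ) := by
      rw [← Complex.ofReal_one, ← Complex.ofReal_add]
      congr 1
      field_simp
      ring
    have e1 : |1 / (1 - t) ^ 2| = Real.exp (-2 * Real.log (1 - t)) := by
      rw [abs_of_pos (by positivity), mul_comm, ← Real.rpow_def_of_pos h1, Real.rpow_neg h1.le]
      norm_num
    have e2 : (1 - (t : ℂ)) = ((1 - t : ℝ) : ℂ) := by push_cast; rfl
    -- Once every factor is an exponential, the identity is linear in `log t` and `log (1 - t)`.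
    have hcpow : ∀ {x : ℝ} (w : ℂ), 0 < x → (x : ℂ) ^ w = Complex.exp (Real.log x * w) := by
      intro x w hx
      rw [Complex.cpow_def_of_ne_zero (Complex.ofReal_ne_zero.2 hx.ne'), Complex.ofReal_log hx.le]
    dsimp only
    rw [e0, e1, e2, hcpow _ (div_pos ht0 h1), hcpow _ (inv_pos.2 h1), hcpow _ ht0, hcpow _ h1,
      Complex.real_smul, smul_eq_mul, Real.log_div ht0.ne' h1.ne', Real.log_inv,
      Complex.ofReal_exp, ← Complex.exp_add, ← Complex.exp_add, ← Complex.exp_add]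
    congr 1
    push_cast
    ring
  have hbeta := Complex.betaIntegral_convergent hu hv
  rw [intervalIntegrable_iff_integrableOn_Ioo_of_le zero_le_one] at hbeta
  refine ⟨?_, ?_⟩
  · rw [MellinConvergent, ← himage,
      integrableOn_image_iff_integrableOn_abs_deriv_smul measurableSet_Ioo hderiv hinj]
    exact hbeta.congr_fun hcongr.symm measurableSet_Ioo
  · rw [mellin, ← himage,
      integral_image_eq_integral_abs_deriv_smul measurableSet_Ioo hderiv hinj,
      setIntegral_congr_fun measurableSet_Ioo hcongr,
      Complex.Gamma_mul_Gamma_eq_betaIntegral hu hv,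
      mul_div_cancel_left₀ _ (Complex.Gamma_ne_zero_of_re_pos (by simpa using add_pos hu hv)),
      Complex.betaIntegral, intervalIntegral.integral_of_le zero_le_one,
      integral_Ioc_eq_integral_Ioo]

theorem measurable_fisherSnedecorPDF (m ms a : ℝ) : Measurable (fisherSnedecorPDF m ms a) := by
  unfold fisherSnedecorPDF
  refine Measurable.ite measurableSet_Ioi ?_ measurable_const
  fun_prop

theorem fisherSnedecorPDF_nonneg {m ms a : ℝ} (hm : 0 < m) (hms : 0 < ms) (ha : 0 < a) (x : ℝ) :
    0 ≤ fisherSnedecorPDF m ms a x := by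
  unfold fisherSnedecorPDF
  split_ifs with hx
  · have := beta_pos hm hms
    positivity
  · exact le_rfl

/-- The exponent `m + ms` is split as `u + v` with `u = m + s`, `v = ms - s`: the moment becomes a
Mellin transform at `u`, with the argument scaled by `a`. -/
theorem fisherSnedecorPDF_smul_cpow {m ms a : ℝ} (hm : 0 < m) (hms : 0 < ms) (ha : 0 < a) (s : ℂ) :
    (fun x : ℝ => (ENNReal.ofReal (fisherSnedecorPDF m ms a x)).toReal • (x : ℂ) ^ s) =
      (Ioi 0).indicator (fun x : ℝ => ((a ^ m / ProbabilityTheory.beta m ms : ℝ) : ℂ) *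
        ((x : ℂ) ^ ((m + s) - 1) • (1 + ((a * x : ℝ) : ℂ)) ^ (-((m + s) + (ms - s))))) := by
  ext x
  rw [ENNReal.toReal_ofReal (fisherSnedecorPDF_nonneg hm hms ha x)]
  by_cases hx : 0 < x
  · have h1 : 0 < 1 + a * x := by positivity
    have hx' : (x : ℂ) ≠ 0 := Complex.ofReal_ne_zero.2 hx.ne'
    rw [indicator_of_mem (mem_Ioi.2 hx), fisherSnedecorPDF, if_pos hx, Complex.real_smul,
      div_eq_mul_inv (x ^ (m - 1)), ← Real.rpow_neg h1.le]
    rw [show (m : ℂ) + s - 1 = (m - 1 : ℝ) + s by push_cast; ring, Complex.cpow_add _ _ hx',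
      show -((m : ℂ) + s + (ms - s)) = ((-(m + ms) : ℝ) : ℂ) by push_cast; ring,
      ← Complex.ofReal_one, ← Complex.ofReal_add, ← Complex.ofReal_cpow h1.le,
      ← Complex.ofReal_cpow hx.le]
    push_cast
    rw [smul_eq_mul]
    ring
  · rw [indicator_of_notMem (by simpa using hx), fisherSnedecorPDF, if_neg hx, zero_smul]

/-- The complex moments of the Fisher–Snedecor distribution exist in the strip `-m < Re s < ms`. -/
theorem integrable_cpow_fisherSnedecorMeasure {m ms a : ℝ} (hm : 0 < m) (hms : 0 < ms)
    (ha : 0 < a) {s : ℂ} (hs : -m < s.re) (hs' : s.re < ms) :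
    Integrable (fun x : ℝ => (x : ℂ) ^ s) (fisherSnedecorMeasure m ms a) := by
  rw [fisherSnedecorMeasure, integrable_withDensity_iff_integrable_smul'
    (measurable_fisherSnedecorPDF m ms a).ennreal_ofReal (by simp),
    fisherSnedecorPDF_smul_cpow hm hms ha, integrable_indicator_iff measurableSet_Ioi]
  have h := (hasMellin_one_add_cpow_neg (u := m + s) (v := ms - s)
    (by simp; linarith) (by simp; linarith)).1
  exact Integrable.const_mul ((MellinConvergent.comp_mul_left ha).2 h) _

theorem integral_cpow_fisherSnedecorMeasure {m ms a : ℝ} (hm : 0 < m) (hms : 0 < ms)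
    (ha : 0 < a) {s : ℂ} (hs : -m < s.re) (hs' : s.re < ms) :
    ∫ x : ℝ, (x : ℂ) ^ s ∂fisherSnedecorMeasure m ms a =
      (a : ℂ) ^ (-s) * (Complex.Gamma (m + s) * Complex.Gamma (ms - s)) /
        (Real.Gamma m * Real.Gamma ms : ℝ) := by
  have ha' : (a : ℂ) ≠ 0 := Complex.ofReal_ne_zero.2 ha.ne'
  have h := (hasMellin_one_add_cpow_neg (u := m + s) (v := ms - s)
    (by simp; linarith) (by simp; linarith)).2
  have h2 := mellin_comp_mul_left
    (fun x : ℝ => (1 + (x : ℂ)) ^ (-((m + s) + ((ms : ℂ) - s)))) (m + s) ha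
  rw [h, mellin] at h2
  rw [fisherSnedecorMeasure, integral_withDensity_eq_integral_toReal_smul
    (measurable_fisherSnedecorPDF m ms a).ennreal_ofReal (by simp),
    fisherSnedecorPDF_smul_cpow hm hms ha, integral_indicator measurableSet_Ioi,
    integral_const_mul, h2, ProbabilityTheory.beta,
    show (m : ℂ) + s + (ms - s) = ((m + ms : ℝ) : ℂ) by push_cast; ring, Complex.Gamma_ofReal,
    smul_eq_mul, neg_add, Complex.cpow_add _ _ ha', Complex.cpow_neg _ (m : ℂ),
    ← Complex.ofReal_cpow ha.le]
  have h3 : ((a ^ m : ℝ) : ℂ) ≠ 0 := Complex.ofReal_ne_zero.2 (Real.rpow_pos_of_pos ha m).ne'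
  have h4 : ((Real.Gamma m : ℝ) : ℂ) ≠ 0 :=
    Complex.ofReal_ne_zero.2 (Real.Gamma_pos_of_pos hm).ne'
  have h5 : ((Real.Gamma ms : ℝ) : ℂ) ≠ 0 :=
    Complex.ofReal_ne_zero.2 (Real.Gamma_pos_of_pos hms).ne'
  have h6 : ((Real.Gamma (m + ms) : ℝ) : ℂ) ≠ 0 :=
    Complex.ofReal_ne_zero.2 (Real.Gamma_pos_of_pos (add_pos hm hms)).ne'
  push_cast
  field_simp

theorem ae_pos_fisherSnedecorMeasure (m ms a : ℝ) :
    ∀ᵐ x ∂fisherSnedecorMeasure m ms a, 0 < x := by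
  rw [fisherSnedecorMeasure,
    ae_withDensity_iff (measurable_fisherSnedecorPDF m ms a).ennreal_ofReal]
  refine ae_of_all _ fun x hx => ?_
  by_contra h
  simp [fisherSnedecorPDF, h] at hx

theorem fisherSnedecorMeasure_singleton (m ms a x : ℝ) : fisherSnedecorMeasure m ms a {x} = 0 :=
  withDensity_absolutelyContinuous _ _ Real.volume_singleton

/-! ### Tail functions: Mellin transform and continuity -/

/-- The Mellin transform of the tail function `t ↦ μ (t < W)` of a positive random variable `W`
at `s` is `s⁻¹ ∫ W ^ s`. -/
theorem hasMellin_measureReal_lt {Ω : Type*} [MeasurableSpace Ω] {μ : Measure Ω}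
    [IsFiniteMeasure μ] {W : Ω → ℝ} (hW : AEMeasurable W μ) (hpos : ∀ᵐ ω ∂μ, 0 < W ω) {s : ℂ}
    (hs : 0 < s.re) (hint : Integrable (fun ω => (W ω : ℂ) ^ s) μ) :
    HasMellin (fun t : ℝ => ((μ.real {ω | t < W ω} : ℝ) : ℂ)) s
      ((∫ ω, (W ω : ℂ) ^ s ∂μ) / s) := by
  have hs1 : -1 < (s - 1).re := by simpa using hs
  have hs0 : s ≠ 0 := by rintro rfl; simp at hs
  -- Fubini for `t ^ (s - 1)` on `{t < W}`: integrating over `ω` first gives the tail, over `t`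
  -- first gives `W ^ s / s`.
  set F : ℝ → Ω → ℂ := fun t ω =>
    ({p : ℝ × Ω | p.1 < W p.2}.indicator (fun p => (p.1 : ℂ) ^ (s - 1))) (t, ω)
  have hset : NullMeasurableSet {p : ℝ × Ω | p.1 < W p.2} ((volume.restrict (Ioi 0)).prod μ) :=
    nullMeasurableSet_lt measurable_fst.aemeasurable hW.comp_snd
  have hmeas : AEStronglyMeasurable (Function.uncurry F) ((volume.restrict (Ioi 0)).prod μ) := by
    refine AEStronglyMeasurable.indicator₀ ?_ hset
    exact Measurable.aestronglyMeasurable (by fun_prop)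
  have hsection : ∀ ω, (fun t => F t ω) = (Iio (W ω)).indicator fun t : ℝ => (t : ℂ) ^ (s - 1) :=
    fun ω => rfl
  have hIoo : ∀ w : ℝ, Ioi 0 ∩ Iio w = Ioo 0 w := fun w => rfl
  have hsec_int : ∀ w : ℝ, 0 < w → IntegrableOn (fun t : ℝ => (t : ℂ) ^ (s - 1)) (Ioo 0 w) := by
    intro w hw
    rw [← intervalIntegrable_iff_integrableOn_Ioo_of_le hw.le]
    exact intervalIntegral.intervalIntegrable_cpow' hs1
  have hsec_val : ∀ w : ℝ, 0 < w → ∫ t in Ioo 0 w, (t : ℂ) ^ (s - 1) = (w : ℂ) ^ s / s := by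
    intro w hw
    rw [← integral_Ioc_eq_integral_Ioo, ← intervalIntegral.integral_of_le hw.le,
      integral_cpow (Or.inl hs1)]
    simp [hs0]
  have hsec_norm : ∀ w : ℝ, 0 < w →
      ∫ t in Ioo 0 w, ‖(t : ℂ) ^ (s - 1)‖ = ‖(w : ℂ) ^ s‖ / s.re := by
    intro w hw
    have : EqOn (fun t : ℝ => ‖(t : ℂ) ^ (s - 1)‖) (fun t => t ^ (s.re - 1)) (Ioo 0 w) := by
      intro t ht
      simp [Complex.norm_cpow_eq_rpow_re_of_pos ht.1]
    rw [setIntegral_congr_fun measurableSet_Ioo this, ← integral_Ioc_eq_integral_Ioo,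
      ← intervalIntegral.integral_of_le hw.le, integral_rpow (Or.inl (by linarith)),
      Complex.norm_cpow_eq_rpow_re_of_pos hw]
    simp [hs.ne']
  have hFint : Integrable (Function.uncurry F) ((volume.restrict (Ioi 0)).prod μ) := by
    rw [integrable_prod_iff' hmeas]
    constructor
    · filter_upwards [hpos] with ω hω
      change Integrable (fun t => F t ω) _
      rw [hsection, integrable_indicator_iff measurableSet_Iio, IntegrableOn,
        Measure.restrict_restrict measurableSet_Iio, inter_comm, hIoo]
      exact hsec_int _ hω
    · refine (hint.norm.div_const s.re).congr ?_
      filter_upwards [hpos] with ω hω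
      change _ = ∫ t in Ioi 0, ‖F t ω‖
      simp_rw [fun t => congrFun (hsection ω) t, norm_indicator_eq_indicator_norm]
      rw [integral_indicator measurableSet_Iio,
        Measure.restrict_restrict measurableSet_Iio, inter_comm, hIoo, hsec_norm _ hω]
  have hinner : ∀ t : ℝ, ∫ ω, F t ω ∂μ =
      (t : ℂ) ^ (s - 1) • ((μ.real {ω | t < W ω} : ℝ) : ℂ) := by
    intro t
    have hn : NullMeasurableSet {ω | t < W ω} μ := nullMeasurableSet_lt aemeasurable_const hW
    have : (fun ω => F t ω) = {ω | t < W ω}.indicator fun _ => (t : ℂ) ^ (s - 1) := rfl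
    rw [this, integral_indicator₀ hn, setIntegral_const, Complex.real_smul, smul_eq_mul, mul_comm]
  refine ⟨?_, ?_⟩
  · have h := hFint.integral_prod_left
    simp only [Function.uncurry_apply_pair, hinner] at h
    exact h
  · simp only [mellin, ← hinner]
    rw [integral_integral_swap hFint, ← integral_div]
    refine integral_congr_ae ?_
    filter_upwards [hpos] with ω hω
    rw [hsection, integral_indicator measurableSet_Iio,
      Measure.restrict_restrict measurableSet_Iio, inter_comm, hIoo, hsec_val _ hω]

/-- The tail function of `W` is continuous at every value that `W` takes with probability `0`. -/
theorem continuousAt_measureReal_lt {Ω : Type*} [MeasurableSpace Ω] {μ : Measure Ω}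
    [IsFiniteMeasure μ] {W : Ω → ℝ} (hW : AEMeasurable W μ) {t₀ : ℝ} (h : ∀ᵐ ω ∂μ, W ω ≠ t₀) :
    ContinuousAt (fun t : ℝ => ((μ.real {ω | t < W ω} : ℝ) : ℂ)) t₀ := by
  have hn : ∀ t, NullMeasurableSet {ω | t < W ω} μ := fun t =>
    nullMeasurableSet_lt aemeasurable_const hW
  have heq : (fun t : ℝ => ((μ.real {ω | t < W ω} : ℝ) : ℂ)) =
      fun t => ∫ ω, {ω | t < W ω}.indicator (fun _ => (1 : ℂ)) ω ∂μ := by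
    ext t
    rw [integral_indicator₀ (hn t), setIntegral_const]
    simp
  rw [heq]
  -- Dominated convergence: if `W ω ≠ t₀`, the indicator is constant in `t` near `t₀`.
  refine continuousAt_of_dominated (bound := fun _ => 1) (Eventually.of_forall fun t =>
    aestronglyMeasurable_const.indicator₀ (hn t)) (Eventually.of_forall fun t =>
    ae_of_all _ fun ω => ?_) (integrable_const _) ?_
  · exact (norm_indicator_le_norm_self _ _).trans (by simp)
  · filter_upwards [h] with ω hω
    rcases lt_or_gt_of_ne hω with hlt | hgt
    · refine (continuousAt_const (y := (0 : ℂ))).congr ?_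
      filter_upwards [lt_mem_nhds hlt] with t ht
      simp [ht.le]
    · refine (continuousAt_const (y := (1 : ℂ))).congr ?_
      filter_upwards [gt_mem_nhds hgt] with t ht
      simp [ht]

/-! ### Decay of Gamma products on vertical lines -/

theorem norm_Gamma_le_Gamma_re {z : ℂ} (hz : 0 < z.re) :
    ‖Complex.Gamma z‖ ≤ Real.Gamma z.re := by
  rw [Complex.Gamma_eq_integral hz, Real.Gamma_eq_integral hz, Complex.GammaIntegral]
  refine (norm_integral_le_integral_norm _).trans (le_of_eq ?_)
  refine setIntegral_congr_fun measurableSet_Ioi fun x hx => ?_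
  have hx : 0 < x := hx
  simp [Complex.norm_cpow_eq_rpow_re_of_pos hx, Complex.norm_exp]

/-- The functional equation `Γ(z + 1) = z Γ(z)` gains one power of decay. Together with the factor
`1 / s` this yields quadratic decay, enough for integrability without Stirling. -/
theorem norm_Gamma_le_div_norm {z : ℂ} (hz : 0 < z.re) :
    ‖Complex.Gamma z‖ ≤ Real.Gamma (z.re + 1) / ‖z‖ := by
  have hz0 : z ≠ 0 := by rintro rfl; simp at hz
  rw [le_div_iff₀ (norm_pos_iff.2 hz0), mul_comm, ← norm_mul, ← Complex.Gamma_add_one z hz0]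
  simpa using norm_Gamma_le_Gamma_re (z := z + 1) (by simp; linarith)

theorem continuous_Gamma_comp {f : ℝ → ℂ} (hf : Continuous f) (hpos : ∀ y, 0 < (f y).re) :
    Continuous fun y => Complex.Gamma (f y) := by
  refine continuous_iff_continuousAt.2 fun y => ?_
  refine ContinuousAt.comp (g := Complex.Gamma) ?_ hf.continuousAt
  refine (Complex.differentiableAt_Gamma _ fun k hk => ?_).continuousAt
  have := hpos y
  rw [hk] at this
  simp at this
  linarith [(Nat.cast_nonneg k : (0:ℝ) ≤ k)]

/-- The product of the Mellin–Barnes kernels of two Fisher–Snedecor distributions, divided by `s`,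
is integrable along vertical lines in the common strip. -/
theorem integrable_Gamma_mul_Gamma_div {p q p' q' c : ℝ} (hp : 0 < p) (hp' : 0 < p')
    (hc : 0 < c) (hq : c < q) (hq' : c < q') :
    Complex.VerticalIntegrable (fun s => Complex.Gamma (p + s) * Complex.Gamma (p' + s) *
      Complex.Gamma (q - s) * Complex.Gamma (q' - s) / s) c := by
  have hre : ∀ y : ℝ, ((c : ℂ) + y * Complex.I).re = c := fun y => by simp
  have hs0 : ∀ y : ℝ, (c : ℂ) + y * Complex.I ≠ 0 := fun y h => by
    have := hre y
    rw [h] at this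
    simp at this
    linarith
  have hcont : Continuous fun y : ℝ => (c : ℂ) + y * Complex.I := by fun_prop
  have hpre : ∀ y : ℝ, 0 < ((p : ℂ) + (c + y * Complex.I)).re := fun y => by simp; linarith
  have hpre' : ∀ y : ℝ, 0 < ((p' : ℂ) + (c + y * Complex.I)).re := fun y => by simp; linarith
  have hqre : ∀ y : ℝ, 0 < ((q : ℂ) - (c + y * Complex.I)).re := fun y => by simp; linarith
  have hqre' : ∀ y : ℝ, 0 < ((q' : ℂ) - (c + y * Complex.I)).re := fun y => by simp; linarith
  -- Only `Γ(p + s)` is bounded with decay, whence the `+ 1`; the other three are bounded by their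
  -- values at the real part.
  set C : ℝ := Real.Gamma (p + c + 1) * Real.Gamma (p' + c) * Real.Gamma (q - c) *
    Real.Gamma (q' - c)
  have hbound : Integrable fun y : ℝ => C * (c ^ 2 + y ^ 2)⁻¹ := by
    refine Integrable.const_mul ?_ C
    have h := (integrable_inv_one_add_sq.comp_div hc.ne').const_mul ((c ^ 2)⁻¹)
    refine h.congr (ae_of_all _ fun y => ?_)
    dsimp only
    rw [← mul_inv]
    congr 1
    field_simp
  refine hbound.mono' ?_ (ae_of_all _ fun y => ?_)
  · refine Continuous.aestronglyMeasurable ?_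
    refine Continuous.div ?_ hcont hs0
    exact (((continuous_Gamma_comp (by fun_prop) hpre).mul
      (continuous_Gamma_comp (by fun_prop) hpre')).mul
      (continuous_Gamma_comp (by fun_prop) hqre)).mul (continuous_Gamma_comp (by fun_prop) hqre')
  · have hsq : ‖(c : ℂ) + y * Complex.I‖ ^ 2 = c ^ 2 + y ^ 2 := by
      rw [← Complex.normSq_eq_norm_sq, Complex.normSq_add_mul_I]
    have hle : ‖(c : ℂ) + y * Complex.I‖ ≤ ‖(p : ℂ) + (c + y * Complex.I)‖ := by
      rw [← sq_le_sq₀ (norm_nonneg _) (norm_nonneg _), hsq, ← add_assoc, ← Complex.ofReal_add,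
        ← Complex.normSq_eq_norm_sq, Complex.normSq_add_mul_I]
      gcongr
      linarith
    have hspos : 0 < ‖(c : ℂ) + y * Complex.I‖ := norm_pos_iff.2 (hs0 y)
    have b1 : ‖Complex.Gamma (p + (c + y * Complex.I))‖ ≤
        Real.Gamma (p + c + 1) / ‖(c : ℂ) + y * Complex.I‖ := by
      refine (norm_Gamma_le_div_norm (hpre y)).trans ?_
      have : 0 < Real.Gamma (p + c + 1) := Real.Gamma_pos_of_pos (by linarith)
      simp only [Complex.add_re, Complex.ofReal_re, hre]
      gcongr
    have b2 := norm_Gamma_le_Gamma_re (hpre' y)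
    have b3 := norm_Gamma_le_Gamma_re (hqre y)
    have b4 := norm_Gamma_le_Gamma_re (hqre' y)
    simp only [Complex.add_re, Complex.sub_re, Complex.ofReal_re, hre] at b2 b3 b4
    have g1 : 0 < Real.Gamma (p + c + 1) := Real.Gamma_pos_of_pos (by linarith)
    rw [norm_div, norm_mul, norm_mul, norm_mul]
    calc _ ≤ Real.Gamma (p + c + 1) / ‖(c : ℂ) + y * Complex.I‖ * Real.Gamma (p' + c) *
          Real.Gamma (q - c) * Real.Gamma (q' - c) / ‖(c : ℂ) + y * Complex.I‖ := by
          gcongr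
      _ = C * (c ^ 2 + y ^ 2)⁻¹ := by
          rw [← hsq]
          field_simp
          rfl

/-! ### Independent variables and Fisher–Snedecor laws -/

/-- The joint law is a product, and each slice of the diagonal is a single point, null for the law
of `Y`. -/
theorem ProbabilityTheory.IndepFun.ae_ne {Ω : Type*} [MeasurableSpace Ω] {μ : Measure Ω}
    [IsFiniteMeasure μ] {X Y : Ω → ℝ} (hXY : IndepFun X Y μ) (hX : AEMeasurable X μ)
    (hY : AEMeasurable Y μ) (hatom : ∀ x, μ.map Y {x} = 0) : ∀ᵐ ω ∂μ, X ω ≠ Y ω := by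
  have hnull : μ.map (fun ω => (X ω, Y ω)) {p : ℝ × ℝ | p.1 = p.2} = 0 := by
    rw [hXY.map_prod_eq_prod_map_map hX hY]
    refine Measure.measure_prod_null_of_ae_null
      (measurableSet_eq_fun measurable_fst measurable_snd) (ae_of_all _ fun x => ?_)
    exact measure_mono_null (fun y hy => (Eq.symm hy : y = x)) (hatom x)
  rw [Measure.map_apply_of_aemeasurable (hX.prodMk hY)
    (measurableSet_eq_fun measurable_fst measurable_snd)] at hnull
  rw [ae_iff]
  simpa using hnull

theorem ae_pos_of_hasLaw_fisherSnedecor {Ω : Type*} [MeasurableSpace Ω] {μ : Measure Ω}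
    {X : Ω → ℝ} {m ms a : ℝ} (hX : HasLaw X (fisherSnedecorMeasure m ms a) μ) :
    ∀ᵐ ω ∂μ, 0 < X ω :=
  (hX.ae_iff (measurableSet_setOfPred.1 measurableSet_Ioi)).2 (ae_pos_fisherSnedecorMeasure m ms a)

theorem integrable_cpow_of_hasLaw_fisherSnedecor {Ω : Type*} [MeasurableSpace Ω] {μ : Measure Ω}
    {X : Ω → ℝ} {m ms a : ℝ} (hX : HasLaw X (fisherSnedecorMeasure m ms a) μ) (hm : 0 < m)
    (hms : 0 < ms) (ha : 0 < a) {s : ℂ} (hs : -m < s.re) (hs' : s.re < ms) :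
    Integrable (fun ω => (X ω : ℂ) ^ s) μ := by
  have h := integrable_cpow_fisherSnedecorMeasure hm hms ha hs hs'
  rw [← hX.map_eq] at h
  exact h.comp_aemeasurable hX.aemeasurable

theorem integral_cpow_of_hasLaw_fisherSnedecor {Ω : Type*} [MeasurableSpace Ω] {μ : Measure Ω}
    {X : Ω → ℝ} {m ms a : ℝ} (hX : HasLaw X (fisherSnedecorMeasure m ms a) μ) (hm : 0 < m)
    (hms : 0 < ms) (ha : 0 < a) {s : ℂ} (hs : -m < s.re) (hs' : s.re < ms) :
    ∫ ω, (X ω : ℂ) ^ s ∂μ = (a : ℂ) ^ (-s) * (Complex.Gamma (m + s) * Complex.Gamma (ms - s)) /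
        (Real.Gamma m * Real.Gamma ms : ℝ) := by
  rw [← integral_cpow_fisherSnedecorMeasure hm hms ha hs hs', ← hX.integral_comp
    (integrable_cpow_fisherSnedecorMeasure hm hms ha hs hs').aestronglyMeasurable]
  rfl

/-! ### The Meijer integrand for these parameters -/

/-- Only the poles with `k = 0` bind, and on the left only that of `Γ(s)` at `0`, since `-mD` and
`-msE` are negative. -/
theorem meijerGSeparates_secrecy_iff {mD msD mE msE c : ℝ} (hmD : 0 < mD) (hmsE : 0 < msE) :
    MeijerGSeparates 3 2 ![1 - (msD : ℂ), 1 - (mE : ℂ), 1] ![(mD : ℂ), (msE : ℂ), 0] c ↔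
      0 < c ∧ c < msD ∧ c < mE := by
  constructor
  · rintro ⟨h1, h2⟩
    have h3 := h1 2 (by norm_num) 0
    have h4 := h2 0 (by norm_num) 0
    have h5 := h2 1 (by norm_num) 0
    simp at h3 h4 h5
    exact ⟨h3, h4, h5⟩
  · rintro ⟨h1, h2, h3⟩
    refine ⟨fun j hj k => ?_, fun j hj k => ?_⟩
    · have hk : (0 : ℝ) ≤ k := Nat.cast_nonneg k
      fin_cases j <;> simp <;> linarith
    · have hk : (0 : ℝ) ≤ k := Nat.cast_nonneg k
      fin_cases j
      · simp; linarith
      · simp; linarith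
      · simp at hj

theorem meijerGIntegrand_secrecy (mD msD mE msE : ℝ) (z : ℂ) {s : ℂ} (hs : 0 < s.re) :
    meijerGIntegrand 3 2 ![1 - (msD : ℂ), 1 - (mE : ℂ), 1] ![(mD : ℂ), (msE : ℂ), 0] z s =
      Complex.Gamma (mD + s) * Complex.Gamma (msE + s) * Complex.Gamma (msD - s) *
        Complex.Gamma (mE - s) / s * z ^ (-s) := by
  have hs0 : s ≠ 0 := by rintro rfl; simp at hs
  have hG := Complex.Gamma_ne_zero_of_re_pos hs
  have h1 : Complex.Gamma (1 + s) = s * Complex.Gamma s := by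
    rw [add_comm, Complex.Gamma_add_one s hs0]
  simp [meijerGIntegrand, Finset.prod_filter, Fin.prod_univ_three, h1]
  left
  field_simp

/-! ### Mellin inversion and the secrecy probability -/

/-- The Mellin transform of the tail function of the quotient of two independent Fisher–Snedecor
variables. -/
theorem hasMellin_tail_div_fisherSnedecor {Ω : Type*} [MeasurableSpace Ω] {μ : Measure Ω}
    [IsProbabilityMeasure μ] {X Y : Ω → ℝ} {m ms a m' ms' a' : ℝ}
    (hm : 0 < m) (hms : 0 < ms) (ha : 0 < a) (hm' : 0 < m') (hms' : 0 < ms') (ha' : 0 < a')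
    (hX : HasLaw X (fisherSnedecorMeasure m ms a) μ)
    (hY : HasLaw Y (fisherSnedecorMeasure m' ms' a') μ) (hXY : IndepFun X Y μ)
    {s : ℂ} (hs : 0 < s.re) (hs1 : s.re < ms) (hs2 : s.re < m') :
    HasMellin (fun t : ℝ => ((μ.real {ω | t < X ω / Y ω} : ℝ) : ℂ)) s
      (((Real.Gamma m * Real.Gamma ms * Real.Gamma m' * Real.Gamma ms' : ℝ) : ℂ)⁻¹ *
        (Complex.Gamma (m + s) * Complex.Gamma (ms' + s) * Complex.Gamma (ms - s) *
          Complex.Gamma (m' - s) / s * ((a : ℂ) / a') ^ (-s))) := by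
  have hXpos : ∀ᵐ ω ∂μ, 0 < X ω :=
    ae_pos_of_hasLaw_fisherSnedecor hX
  have hYpos : ∀ᵐ ω ∂μ, 0 < Y ω :=
    ae_pos_of_hasLaw_fisherSnedecor hY
  have hXint := integrable_cpow_of_hasLaw_fisherSnedecor hX hm hms ha (s := s)
    (by linarith) hs1
  have hYint := integrable_cpow_of_hasLaw_fisherSnedecor hY hm' hms' ha' (s := -s)
    (by simpa using hs2) (by simp; linarith)
  have hind : IndepFun (fun ω => (X ω : ℂ) ^ s) (fun ω => (Y ω : ℂ) ^ (-s)) μ :=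
    hXY.comp (φ := fun x : ℝ => (x : ℂ) ^ s) (ψ := fun y : ℝ => (y : ℂ) ^ (-s))
      (by fun_prop) (by fun_prop)
  -- Positivity keeps the bases off the branch cut of the complex power.
  have hdiv : ∀ x y : ℝ, 0 < x → 0 < y →
      (x : ℂ) ^ s * (y : ℂ) ^ (-s) = ((x / y : ℝ) : ℂ) ^ s := by
    intro x y hx hy
    rw [div_eq_mul_inv, Complex.ofReal_mul, Complex.mul_cpow_ofReal_nonneg hx.le (by positivity),
      Complex.ofReal_inv, Complex.inv_cpow _ _ (by
        rw [Complex.arg_ofReal_of_nonneg hy.le]; exact Real.pi_ne_zero.symm), Complex.cpow_neg]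
  have hcongr : (fun ω => (X ω : ℂ) ^ s * (Y ω : ℂ) ^ (-s)) =ᵐ[μ]
      fun ω => ((X ω / Y ω : ℝ) : ℂ) ^ s := by
    filter_upwards [hXpos, hYpos] with ω hx hy using hdiv _ _ hx hy
  have hWint : Integrable (fun ω => ((X ω / Y ω : ℝ) : ℂ) ^ s) μ :=
    (hind.integrable_mul hXint hYint).congr hcongr
  have h := hasMellin_measureReal_lt (W := fun ω => X ω / Y ω) (hX.aemeasurable.div hY.aemeasurable)
    (by filter_upwards [hXpos, hYpos] with ω hx hy using div_pos hx hy) hs hWint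
  refine ⟨h.1, h.2.trans ?_⟩
  rw [← integral_congr_ae hcongr, hind.integral_fun_mul_eq_mul_integral
    hXint.aestronglyMeasurable hYint.aestronglyMeasurable,
    integral_cpow_of_hasLaw_fisherSnedecor hX hm hms ha (by linarith) hs1,
    integral_cpow_of_hasLaw_fisherSnedecor hY hm' hms' ha' (by simpa using hs2)
      (by simp; linarith), neg_neg, sub_neg_eq_add, ← sub_eq_add_neg]
  have hz : ((a : ℂ) / a') ^ (-s) = (a : ℂ) ^ (-s) * (a' : ℂ) ^ s := by
    have h := hdiv a' a ha' ha
    rw [mul_comm, h, Complex.cpow_neg, ← Complex.ofReal_div, ← Complex.inv_cpow _ _ (by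
      rw [Complex.arg_ofReal_of_nonneg (by positivity)]; exact Real.pi_ne_zero.symm),
      ← Complex.ofReal_inv, inv_div]
  rw [hz]
  push_cast
  simp only [div_eq_mul_inv, mul_inv]
  ring

/-- The probability that one of two independent Fisher–Snedecor variables exceeds the other, as a
Meijer function. -/
theorem hasMeijerG_of_fisherSnedecor {Ω : Type*} [MeasurableSpace Ω] {μ : Measure Ω}
    [IsProbabilityMeasure μ] {X Y : Ω → ℝ} {m ms a m' ms' a' : ℝ}
    (hm : 0 < m) (hms : 0 < ms) (ha : 0 < a) (hm' : 0 < m') (hms' : 0 < ms') (ha' : 0 < a')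
    (hX : HasLaw X (fisherSnedecorMeasure m ms a) μ)
    (hY : HasLaw Y (fisherSnedecorMeasure m' ms' a') μ) (hXY : IndepFun X Y μ) :
    HasMeijerG 3 2 ![1 - (ms : ℂ), 1 - (m' : ℂ), 1] ![(m : ℂ), (ms' : ℂ), 0] ((a : ℂ) / (a' : ℂ))
      (((Real.Gamma m * Real.Gamma ms * Real.Gamma m' * Real.Gamma ms' : ℝ) : ℂ) *
        ((μ.real {ω | Y ω < X ω} : ℝ) : ℂ)) := by
  have hYpos : ∀ᵐ ω ∂μ, 0 < Y ω :=
    ae_pos_of_hasLaw_fisherSnedecor hY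
  set K : ℂ := ((Real.Gamma m * Real.Gamma ms * Real.Gamma m' * Real.Gamma ms' : ℝ) : ℂ)
  have hK0 : K ≠ 0 := by
    have := Real.Gamma_pos_of_pos hm
    have := Real.Gamma_pos_of_pos hms
    have := Real.Gamma_pos_of_pos hm'
    have := Real.Gamma_pos_of_pos hms'
    exact Complex.ofReal_ne_zero.2 (by positivity)
  refine ⟨⟨min ms m' / 2, ?_⟩, fun c hc => ?_⟩
  · rw [meijerGSeparates_secrecy_iff hm hms']
    have h0 := lt_min hms hm'
    have h1 := min_le_left ms m'
    have h2 := min_le_right ms m'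
    refine ⟨?_, ?_, ?_⟩ <;> linarith
  obtain ⟨hc0, hc1, hc2⟩ := (meijerGSeparates_secrecy_iff hm hms').1 hc
  have hre : ∀ y : ℝ, ((c : ℂ) + y * Complex.I).re = c := fun y => by simp
  set f : ℝ → ℂ := fun t => ((μ.real {ω | t < X ω / Y ω} : ℝ) : ℂ) with hf
  have hmellin : ∀ s : ℂ, s.re = c → HasMellin f s _ := fun s hs =>
    hasMellin_tail_div_fisherSnedecor hm hms ha hm' hms' ha' hX hY hXY
      (by rw [hs]; exact hc0) (by rw [hs]; exact hc1) (by rw [hs]; exact hc2)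
  have hintegrand : ∀ y : ℝ, meijerGIntegrand 3 2 ![1 - (ms : ℂ), 1 - (m' : ℂ), 1]
      ![(m : ℂ), (ms' : ℂ), 0] ((a : ℂ) / (a' : ℂ)) ((c : ℂ) + y * Complex.I) =
        K * mellin f (c + y * Complex.I) := by
    intro y
    rw [(hmellin _ (hre y)).2, meijerGIntegrand_secrecy _ _ _ _ _ (by rw [hre]; exact hc0),
      mul_inv_cancel_left₀ hK0]
  have hz : 0 < a / a' := div_pos ha ha'
  -- On the line, `(a / a') ^ (-s)` has constant modulus `(a / a') ^ (-c)`.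
  have hvert : Complex.VerticalIntegrable (mellin f) c := by
    have h := (integrable_Gamma_mul_Gamma_div hm hms' hc0 hc1 hc2).mul_bdd (c := (a / a') ^ (-c))
      (g := fun y : ℝ => ((a : ℂ) / a') ^ (-((c : ℂ) + y * Complex.I)))
      (Measurable.aestronglyMeasurable (by fun_prop)) (ae_of_all _ fun y => by
        rw [← Complex.ofReal_div, Complex.norm_cpow_eq_rpow_re_of_pos hz, Complex.neg_re, hre])
    refine (h.const_mul K⁻¹).congr (ae_of_all _ fun y => ?_)
    exact (hmellin _ (hre y)).2.symm
  have hne : ∀ᵐ ω ∂μ, X ω / Y ω ≠ 1 := by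
    filter_upwards [hXY.ae_ne hX.aemeasurable hY.aemeasurable (fun x => by
      rw [hY.map_eq]; exact fisherSnedecorMeasure_singleton m' ms' a' x), hYpos] with ω hω hy
    rwa [ne_eq, div_eq_one_iff_eq hy.ne']
  have hf1 : f 1 = ((μ.real {ω | Y ω < X ω} : ℝ) : ℂ) := by
    simp only [hf]
    congr 1
    refine measureReal_congr ?_
    filter_upwards [hYpos] with ω hy
    exact propext (one_lt_div hy)
  have hinv := mellinInv_mellin_eq c f one_pos (hmellin c (by simp)).1 hvert
    (continuousAt_measureReal_lt (hX.aemeasurable.div hY.aemeasurable) hne)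
  refine ⟨?_, ?_⟩
  · simp_rw [hintegrand]
    exact hvert.const_mul K
  · rw [← hf1, ← hinv, meijerGLineIntegral, mellinInv]
    simp_rw [hintegrand]
    -- The `I` from `ds = I dy` cancels against `1 / (2πI)`, leaving the `1 / (2π)` of `mellinInv`.
    rw [integral_mul_const, integral_const_mul]
    simp only [Complex.ofReal_one, Complex.one_cpow, one_smul, Complex.real_smul]
    push_cast
    have hpi : (Real.pi : ℂ) ≠ 0 := Complex.ofReal_ne_zero.2 Real.pi_ne_zero
    field_simp

theorem secrecyCapacity_pos_iff {x y : ℝ} (hx : 0 < x) (hy : 0 < y) :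
    0 < secrecyCapacity x y ↔ y < x := by
  rw [secrecyCapacity, lt_max_iff, or_iff_left (lt_irrefl _), sub_pos, awgnCapacity, awgnCapacity,
    Real.log_lt_log_iff (by linarith) (by linarith), add_lt_add_iff_left]

theorem theorem1 {Ω : Type*} [MeasurableSpace Ω]
    (μ : MeasureTheory.Measure Ω) [MeasureTheory.IsProbabilityMeasure μ]
    (γD γE : Ω → ℝ)
    (mD msD aD mE msE aE : ℝ)
    (hmD : 0 < mD) (hmsD : 0 < msD) (haD : 0 < aD)
    (hmE : 0 < mE) (hmsE : 0 < msE) (haE : 0 < aE)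
    (hD : ProbabilityTheory.HasLaw γD (fisherSnedecorMeasure mD msD aD) μ)
    (hE : ProbabilityTheory.HasLaw γE (fisherSnedecorMeasure mE msE aE) μ)
    (hindep : ProbabilityTheory.IndepFun γD γE μ) :
    -- the Meijer function on the right-hand side is given by a convergent integral
    HasMeijerG 3 2 ![1 - (msD : ℂ), 1 - (mE : ℂ), 1] ![(mD : ℂ), (msE : ℂ), 0]
        ((aD : ℂ) / (aE : ℂ))
        (meijerG 3 2 ![1 - (msD : ℂ), 1 - (mE : ℂ), 1] ![(mD : ℂ), (msE : ℂ), 0]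
          ((aD : ℂ) / (aE : ℂ))) ∧
    -- a positive secrecy capacity is the event that the main channel is the better one
    μ.real {ω | 0 < secrecyCapacity (γD ω) (γE ω)} = μ.real {ω | γE ω < γD ω} ∧
    -- its probability
    ((μ.real {ω | 0 < secrecyCapacity (γD ω) (γE ω)} : ℝ) : ℂ) =
      ((Real.Gamma mD * Real.Gamma msD * Real.Gamma mE * Real.Gamma msE : ℝ) : ℂ)⁻¹ *
        meijerG 3 2 ![1 - (msD : ℂ), 1 - (mE : ℂ), 1] ![(mD : ℂ), (msE : ℂ), 0]
          ((aD : ℂ) / (aE : ℂ)) := by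
  have hDpos : ∀ᵐ ω ∂μ, 0 < γD ω :=
    ae_pos_of_hasLaw_fisherSnedecor hD
  have hEpos : ∀ᵐ ω ∂μ, 0 < γE ω :=
    ae_pos_of_hasLaw_fisherSnedecor hE
  have hevent : μ.real {ω | 0 < secrecyCapacity (γD ω) (γE ω)} = μ.real {ω | γE ω < γD ω} := by
    refine measureReal_congr ?_
    filter_upwards [hDpos, hEpos] with ω hx hy
    exact propext (secrecyCapacity_pos_iff hx hy)
  have hG := hasMeijerG_of_fisherSnedecor hmD hmsD haD hmE hmsE haE hD hE hindep
  have hK : ((Real.Gamma mD * Real.Gamma msD * Real.Gamma mE * Real.Gamma msE : ℝ) : ℂ) ≠ 0 := by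
    have := Real.Gamma_pos_of_pos hmD
    have := Real.Gamma_pos_of_pos hmsD
    have := Real.Gamma_pos_of_pos hmE
    have := Real.Gamma_pos_of_pos hmsE
    exact Complex.ofReal_ne_zero.2 (by positivity)
  rw [hG.meijerG_eq]
  refine ⟨hG, hevent, ?_⟩
  rw [hevent, inv_mul_cancel_left₀ hK]
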